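/- Let $k\ge 2$. Define two graphs $\Gamma$ and $\Gamma'$ as follows. Let $I$, $J$, $O$ denote identity, all-ones and all-zeros matrices of the indicated sizes, and put \[ N=\begin{bmatrix} I_{k+1}\\ J_{k-1,k+1}\end{bmatrix},\qquad K=\begin{bmatrix} O_{k,k-1}\\ J_{k,k-1}\end{bmatrix},\qquad M=[\,J-N\ \ K\ \ J-K\,]. \] Let $B$ be the adjacency matrix of the graph on the integers modulo $3k-1$ in which $i$ is adjacent to $i+k,i+k+1,\dots,i+2k-1$, with the vertices listed in the order $0;\ k,\dots,2k-1;\ 1,\dots,k-1;\ 2k,\dots,3k-2$. Let $\Gamma$ be the graph with adjacency matrix \[ A=\begin{bmatrix} O_{2k,2k} & N & M\\ N^\top & J-I_{k+1} & O\\ M^\top & O & B\end{bmatrix}, \] and let $X$ be the set of its first $2k$ vertices. Then $\Gamma$ has $6k$ vertices, and $X$ is a Godsil–McKay switching set of $\Gamma$: it induces a regular subgraph, and every vertex outside $X$ is adjacent to none, exactly half, or all of the vertices of $X$. Let $\Gamma'$ be obtained from $\Gamma$ by Godsil–McKay switching with respect to $X$, that is, for each vertex $y\notin X$ adjacent to exactly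 half of $X$, replace the neighbours of $y$ in $X$ by the other vertices of $X$. Then $\Gamma$ and $\Gamma'$ are both $2k$-regular, their adjacency matrices have the same spectrum (eigenvalues with multiplicities), $\Gamma$ has vertex-connectivity $2k$, and $\Gamma'$ has vertex-connectivity $k+1$. In particular, for every $k\ge 2$ there is a pair of $2k$-regular graphs on $6k$ vertices with the same adjacency spectrum, one with vertex-connectivity $2k$ and the other with vertex-connectivity $k+1$. (The vertex-connectivity of a graph is the minimum number of vertices whose deletion leaves a disconnected graph or a graph with at most one vertex.) -/

import Mathlib

namespace HaemersConnectivity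

/-- A set `S` of vertices of `G` is separating if deleting it leaves a disconnected graph, or (the
usual convention, which only matters for complete graphs) a graph with at most one vertex. -/
def IsSeparating {V : Type*} (G : SimpleGraph V) (S : Finset V) : Prop :=
  ¬ (G.induce {v | v ∉ S}).Preconnected ∨ {v | v ∉ S}.Subsingleton

/-- The vertex-connectivity of a finite graph: the minimum number of vertices one has to delete
to make it disconnected (or to reduce it to at most one vertex). -/
noncomputable def vertexConnectivity {V : Type*} (G : SimpleGraph V) : ℕ :=
  sInf {n | ∃ S : Finset V, S.card = n ∧ IsSeparating G S}

/-- On a finite vertex set, the minimum in the definition of `vertexConnectivity` is attained. -/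
theorem isLeast_vertexConnectivity {V : Type*} [Fintype V] (G : SimpleGraph V) :
    IsLeast {n | ∃ S : Finset V, S.card = n ∧ IsSeparating G S} (vertexConnectivity G) := by
  have hne : {n | ∃ S : Finset V, S.card = n ∧ IsSeparating G S}.Nonempty :=
    ⟨_, Finset.univ, rfl, Or.inr (by intro v hv; exact absurd (Finset.mem_univ v) hv)⟩
  exact ⟨Nat.sInf_mem hne, fun n hn => Nat.sInf_le hn⟩

/-- The adjacency spectrum of a graph: the multiset of eigenvalues of its adjacency matrix. -/
noncomputable def adjSpectrum {V : Type*} [Fintype V] [DecidableEq V] (G : SimpleGraph V)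
    [DecidableRel G.Adj] : Multiset ℝ :=
  (G.adjMatrix ℝ).charpoly.roots

/-- The number of neighbours of `y` in `X`. -/
def nbrsIn {V : Type*} (G : SimpleGraph V) [DecidableRel G.Adj] (X : Finset V) (y : V) : ℕ :=
  (X.filter (fun x => G.Adj y x)).card

/-- `X` is a Godsil–McKay switching set of `G`: it induces a regular subgraph, and every vertex
outside `X` is adjacent to none, exactly half, or all of the vertices of `X`. -/
def IsGMSwitchingSet {V : Type*} (G : SimpleGraph V) [DecidableRel G.Adj] (X : Finset V) : Prop :=
  (∃ d, ∀ x ∈ X, nbrsIn G X x = d) ∧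
  ∀ y, y ∉ X → nbrsIn G X y = 0 ∨ 2 * nbrsIn G X y = X.card ∨ nbrsIn G X y = X.card

/-- The pair `x, y` is flipped in Godsil–McKay switching with respect to `X`: `x` is in `X`, `y` is
not, and `y` is adjacent to exactly half of the vertices of `X`. -/
def IsFlipped {V : Type*} (G : SimpleGraph V) [DecidableRel G.Adj] (X : Finset V) (x y : V) :
    Prop :=
  x ∈ X ∧ y ∉ X ∧ 2 * nbrsIn G X y = X.card

instance {V : Type*} [DecidableEq V] (G : SimpleGraph V) [DecidableRel G.Adj] (X : Finset V)
    (x y : V) : Decidable (IsFlipped G X x y) := by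
  unfold IsFlipped; infer_instance

/-- Godsil–McKay switching of `G` with respect to `X`: for every vertex `y` outside `X` with exactly
half of `X` as neighbours, edges and non-edges between `y` and `X` are interchanged; all other
adjacencies are kept. -/
def gmSwitch {V : Type*} (G : SimpleGraph V) [DecidableRel G.Adj] (X : Finset V) :
    SimpleGraph V where
  Adj x y := ((IsFlipped G X x y ∨ IsFlipped G X y x) ∧ ¬ G.Adj x y) ∨
    (¬ (IsFlipped G X x y ∨ IsFlipped G X y x) ∧ G.Adj x y)
  symm := ⟨fun x y h => by rwa [or_comm (a := IsFlipped G X y x), G.adj_comm y x]⟩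
  loopless := ⟨fun x h => by
    rcases h with ⟨h | h, -⟩ | ⟨-, h⟩
    · exact h.2.1 h.1
    · exact h.2.1 h.1
    · exact G.loopless.irrefl x h⟩

instance {V : Type*} [DecidableEq V] (G : SimpleGraph V) [DecidableRel G.Adj] (X : Finset V) :
    DecidableRel (gmSwitch G X).Adj := fun x y => by
  unfold gmSwitch; infer_instance

/-- The `k`-regular graph on the integers modulo `3k - 1` in which `i` is adjacent to
`i + k, i + k + 1, …, i + 2k - 1`. -/
def baseGraph (k : ℕ) : SimpleGraph (Fin (3 * k - 1)) where
  Adj i j := ∃ t ∈ Finset.Ico k (2 * k), (i + t) % (3 * k - 1) = j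
  symm := ⟨by
    rintro i j ⟨t, ht, h⟩
    rw [Finset.mem_Ico] at ht
    have hi := i.isLt
    refine ⟨3 * k - 1 - t, by rw [Finset.mem_Ico]; omega, ?_⟩
    by_cases hlt : i + t < 3 * k - 1
    · rw [Nat.mod_eq_of_lt hlt] at h
      have : (j : ℕ) + (3 * k - 1 - t) = i + (3 * k - 1) := by omega
      rw [this, Nat.add_mod_right, Nat.mod_eq_of_lt hi]
    · rw [Nat.mod_eq_sub_mod (by omega), Nat.mod_eq_of_lt (by omega)] at h
      have : (j : ℕ) + (3 * k - 1 - t) = i := by omega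
      rw [this, Nat.mod_eq_of_lt hi]⟩
  loopless := ⟨by
    rintro i ⟨t, ht, h⟩
    rw [Finset.mem_Ico] at ht
    have hi := i.isLt
    by_cases hlt : i + t < 3 * k - 1
    · rw [Nat.mod_eq_of_lt hlt] at h; omega
    · rw [Nat.mod_eq_sub_mod (by omega), Nat.mod_eq_of_lt (by omega)] at h; omega⟩

instance (k : ℕ) : DecidableRel (baseGraph k).Adj := fun i j => by
  unfold baseGraph; infer_instance

/-- The entries equal to `1` of the `2k × (k+1)` matrix `N` consisting of the identity matrix
`I` of order `k + 1` on top of the all-ones matrix with `k - 1` rows. -/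
def entryN (k x u : ℕ) : Prop := x = u ∨ k + 1 ≤ x

/-- The entries equal to `1` of the `2k × (3k-1)` matrix `M = [J - N, K, J - K]`, where `K` consists
of `k` zero rows followed by `k` all-ones rows. Its columns are labelled by the integers
`0, …, 3k - 2`: the columns of `J - N` are labelled, in this order, `0, k, k + 1, …, 2k - 1`, those
of `K` are labelled `1, …, k - 1`, and those of `J - K` are labelled `2k, …, 3k - 2`. -/
def entryM (k x v : ℕ) : Prop :=
  if v = 0 then ¬ entryN k x 0
  else if v < k then k ≤ x
  else if v < 2 * k then ¬ entryN k x (v - k + 1)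
  else ¬ k ≤ x

instance (k x u : ℕ) : Decidable (entryN k x u) := by unfold entryN; infer_instance

instance (k x v : ℕ) : Decidable (entryM k x v) := by unfold entryM; infer_instance

/-- The vertices of the graph `gamma k`: three classes `X`, `U`, `V`
of sizes `2k`, `k + 1`, `3k - 1`. -/
abbrev GammaVertex (k : ℕ) : Type := Fin (2 * k) ⊕ Fin (k + 1) ⊕ Fin (3 * k - 1)

/-- Adjacency in `gamma k`; as a matrix it is `[[0, N, M], [Nᵀ, J - I, 0], [Mᵀ, 0, B]]`, where `B`
is the adjacency matrix of `baseGraph k`. -/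
def gammaAdj (k : ℕ) : GammaVertex k → GammaVertex k → Prop
  | .inl _, .inl _ => False
  | .inl x, .inr (.inl u) => entryN k x u
  | .inl x, .inr (.inr v) => entryM k x v
  | .inr (.inl u), .inl x => entryN k x u
  | .inr (.inl u), .inr (.inl u') => u ≠ u'
  | .inr (.inl _), .inr (.inr _) => False
  | .inr (.inr v), .inl x => entryM k x v
  | .inr (.inr _), .inr (.inl _) => False
  | .inr (.inr v), .inr (.inr v') => (baseGraph k).Adj v v'

/-- The graph `Γ` of degree `2k` on `6k` vertices. -/
def gamma (k : ℕ) : SimpleGraph (GammaVertex k) where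
  Adj := gammaAdj k
  symm := ⟨by
    rintro (x | u | v) (x' | u' | v') h <;> simp only [gammaAdj] at h ⊢
    · exact h
    · exact h
    · exact h
    · exact h.symm
    · exact h
    · exact h.symm⟩
  loopless := ⟨by
    rintro (x | u | v) h <;> simp only [gammaAdj] at h
    · exact h rfl
    · exact (baseGraph k).loopless.irrefl v h⟩

instance (k : ℕ) : DecidableRel (gamma k).Adj
  | .inl _, .inl _ => inferInstanceAs (Decidable False)
  | .inl x, .inr (.inl u) => inferInstanceAs (Decidable (entryN k x u))
  | .inl x, .inr (.inr v) => inferInstanceAs (Decidable (entryM k x v))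
  | .inr (.inl u), .inl x => inferInstanceAs (Decidable (entryN k x u))
  | .inr (.inl u), .inr (.inl u') => inferInstanceAs (Decidable (u ≠ u'))
  | .inr (.inl _), .inr (.inr _) => inferInstanceAs (Decidable False)
  | .inr (.inr v), .inl x => inferInstanceAs (Decidable (entryM k x v))
  | .inr (.inr _), .inr (.inl _) => inferInstanceAs (Decidable False)
  | .inr (.inr v), .inr (.inr v') => inferInstanceAs (Decidable ((baseGraph k).Adj v v'))

/-- The class `X` of the vertices of `gamma k`. -/
def switchingSet (k : ℕ) : Finset (GammaVertex k) :=
  Finset.univ.map Function.Embedding.inl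

end HaemersConnectivity

open HaemersConnectivity

/-! ### Adjacency in coordinates; row and column counts of the blocks. -/

namespace HaemersConnectivity

/-! Write `W = [N M]`. `X` is independent and every column of `W` sums to `k`, half of `|X|`, so
switching replaces all of `W` by `J - W`. The matrix `Q = J/k - I` of order `2k` is a symmetric
involution with `Q W = J - W`, so conjugation by `diag(Q, I)` carries one adjacency matrix to the
other (`charpoly_fromBlocks_complement`). Regularity is a count of rows and columns.

Upper bounds: in `Γ` the neighbourhood of a vertex isolates it. After switching, the rows of `J - N`
below the first `k + 1` vanish, so the vertices `0, …, k` of `X` cut off `U`.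

Lower bounds: delete a set `S` with fewer than `n` vertices, fix a remaining root, and let `C` be
the set of remaining vertices not reachable from it. A neighbour of a vertex of `C` is deleted or
again in `C`. Emptiness of `C` is proved class by class, in the manner of Menger: to exclude `c`
from `C`, exhibit `n` disjoint paths from `c` to vertices already excluded. The paths are encoded by
labelling the vertices with numbers, path `t` carrying the label `t`. Since `|S| < n`, some `t < n`
labels no deleted vertex (the field `count`), so path `t` is intact and carries membership in `C` to
its end, a contradiction. Vertices on no path may receive any label.

The columns of `M` are grouped below as follows: `0` and `k, …, 2k-1` (block `J - N`, each missing
one row among `0, …, k`), `1, …, k-1` (block `K`), and `2k, …, 3k-2` (block `J - K`). -/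

theorem baseGraph_adj_iff {k : ℕ} (i j : Fin (3 * k - 1)) :
    (baseGraph k).Adj i j ↔
      ((i : ℕ) + k ≤ j ∧ (j : ℕ) < i + 2 * k) ∨ ((j : ℕ) + k ≤ i ∧ (i : ℕ) < j + 2 * k) := by
  have hi := i.isLt
  have hj := j.isLt
  constructor
  · rintro ⟨t, ht, h⟩
    rw [Finset.mem_Ico] at ht
    by_cases hlt : i + t < 3 * k - 1
    · rw [Nat.mod_eq_of_lt hlt] at h; omega
    · rw [Nat.mod_eq_sub_mod (by omega), Nat.mod_eq_of_lt (by omega)] at h; omega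
  · rintro (⟨h₁, h₂⟩ | ⟨h₁, h₂⟩)
    · refine ⟨j - i, by rw [Finset.mem_Ico]; omega, ?_⟩
      rw [show (i : ℕ) + (j - i) = j by omega, Nat.mod_eq_of_lt hj]
    · refine ⟨j + (3 * k - 1) - i, by rw [Finset.mem_Ico]; omega, ?_⟩
      rw [show (i : ℕ) + (j + (3 * k - 1) - i) = j + (3 * k - 1) by omega, Nat.add_mod_right,
        Nat.mod_eq_of_lt hj]

theorem entryM_iff {k x v : ℕ} :
    entryM k x v ↔ (v = 0 ∧ x ≠ 0 ∧ x ≤ k) ∨ (1 ≤ v ∧ v < k ∧ k ≤ x) ∨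
      (v ≠ 0 ∧ k ≤ v ∧ v < 2 * k ∧ x ≠ v - k + 1 ∧ x ≤ k) ∨ (v ≠ 0 ∧ 2 * k ≤ v ∧ x < k) := by
  unfold entryM entryN
  split_ifs <;> omega

/-- Counting the elements of `Fin n` with a property through an explicit set of numbers. -/
theorem card_fin_filter_eq {n : ℕ} (p : Fin n → Prop) [DecidablePred p] (s : Finset ℕ)
    (hs : ∀ i ∈ s, i < n) (h : ∀ i : Fin n, p i ↔ (i : ℕ) ∈ s) :
    (Finset.univ.filter p).card = s.card := by
  rw [← Finset.card_map Fin.valEmbedding]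
  congr 1
  ext i
  simp only [Finset.mem_map, Finset.mem_filter, Finset.mem_univ, true_and, Fin.valEmbedding_apply]
  constructor
  · rintro ⟨a, ha, rfl⟩
    exact (h a).1 ha
  · intro hi
    exact ⟨⟨i, hs i hi⟩, (h _).2 hi, rfl⟩

theorem card_entryN_col {k : ℕ} (hk : 2 ≤ k) (u : Fin (k + 1)) :
    (Finset.univ.filter fun x : Fin (2 * k) => entryN k x u).card = k := by
  have hu := u.isLt
  rw [card_fin_filter_eq _ (insert (u : ℕ) (Finset.Ico (k + 1) (2 * k)))]
  · rw [Finset.card_insert_of_notMem (by simp; omega), Nat.card_Ico]; omega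
  · simp; omega
  · intro i; have := i.isLt; simp [entryN]

theorem card_entryM_col {k : ℕ} (hk : 2 ≤ k) (v : Fin (3 * k - 1)) :
    (Finset.univ.filter fun x : Fin (2 * k) => entryM k x v).card = k := by
  have hv := v.isLt
  have key : ∀ c ≤ k, ((Finset.range (k + 1)).erase c).card = k := by
    intro c hc
    rw [Finset.card_erase_of_mem (by simp; omega), Finset.card_range]; omega
  by_cases h0 : (v : ℕ) = 0
  · rw [card_fin_filter_eq _ ((Finset.range (k + 1)).erase 0), key _ (by omega)]
    · simp; omega
    · intro i; have := i.isLt; simp [entryM_iff]; omega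
  by_cases h1 : (v : ℕ) < k
  · rw [card_fin_filter_eq _ (Finset.Ico k (2 * k)), Nat.card_Ico]
    · omega
    · simp
    · intro i; have := i.isLt; simp [entryM_iff]; omega
  by_cases h2 : (v : ℕ) < 2 * k
  · rw [card_fin_filter_eq _ ((Finset.range (k + 1)).erase (v - k + 1)), key _ (by omega)]
    · simp; omega
    · intro i; have := i.isLt; simp [entryM_iff]; omega
  · rw [card_fin_filter_eq _ (Finset.range k), Finset.card_range]
    · simp; omega
    · intro i; have := i.isLt; simp [entryM_iff]; omega

theorem card_baseGraph_nbrs {k : ℕ} (i : Fin (3 * k - 1)) :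
    (Finset.univ.filter fun j => (baseGraph k).Adj i j).card = k := by
  have hi := i.isLt
  -- The second interval is the part of the neighbourhood below `i`; truncated subtraction cuts it
  -- off at `0`.
  rw [card_fin_filter_eq _ (Finset.Ico (i + k) (min (i + 2 * k) (3 * k - 1)) ∪
    Finset.Ico (i + 1 - 2 * k) (i + 1 - k)), Finset.card_union_of_disjoint]
  · simp only [Nat.card_Ico]; omega
  · rw [Finset.disjoint_left]; simp; omega
  · simp; omega
  · intro j; have := j.isLt; rw [baseGraph_adj_iff]; simp; omega

theorem card_fin_ne {k : ℕ} (u : Fin (k + 1)) :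
    (Finset.univ.filter fun u' => u ≠ u').card = k := by
  rw [Finset.filter_ne, Finset.card_erase_of_mem (Finset.mem_univ u), Finset.card_univ,
    Fintype.card_fin]; rfl

theorem card_entryN_row_add_card_entryM_row {k : ℕ} (hk : 2 ≤ k) (x : Fin (2 * k)) :
    (Finset.univ.filter fun u : Fin (k + 1) => entryN k x u).card +
      (Finset.univ.filter fun v : Fin (3 * k - 1) => entryM k x v).card = 2 * k := by
  have hx := x.isLt
  by_cases h : (x : ℕ) ≤ k
  · rw [card_fin_filter_eq (fun u : Fin (k + 1) => entryN k x u) {(x : ℕ)},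
      Finset.card_singleton]
    · by_cases h0 : (x : ℕ) = 0
      · rw [card_fin_filter_eq _ (Finset.Ico k (3 * k - 1)), Nat.card_Ico]
        · omega
        · simp
        · intro i; have := i.isLt; simp [entryM_iff]; omega
      by_cases h1 : (x : ℕ) < k
      · rw [card_fin_filter_eq _ (insert 0 ((Finset.Ico k (3 * k - 1)).erase (k + x - 1))),
          Finset.card_insert_of_notMem (by simp; omega),
          Finset.card_erase_of_mem (by simp; omega), Nat.card_Ico]
        · omega
        · simp; omega
        · intro i; have := i.isLt; simp [entryM_iff]; omega
      · rw [card_fin_filter_eq _ (Finset.range (2 * k - 1)), Finset.card_range]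
        · omega
        · simp; omega
        · intro i; have := i.isLt; simp [entryM_iff]; omega
    · simp; omega
    · intro i; have := i.isLt; simp [entryN]; omega
  · rw [card_fin_filter_eq (fun u : Fin (k + 1) => entryN k x u) (Finset.range (k + 1)),
      card_fin_filter_eq _ (Finset.Ico 1 k), Finset.card_range, Nat.card_Ico]
    · omega
    · simp; omega
    · intro i; have := i.isLt; simp [entryM_iff]; omega
    · simp
    · intro i; have := i.isLt; simp [entryN]; omega

theorem nbrsIn_switchingSet (k : ℕ) (y : GammaVertex k) :
    nbrsIn (gamma k) (switchingSet k) y =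
      (Finset.univ.filter fun x : Fin (2 * k) => (gamma k).Adj y (.inl x)).card := by
  unfold nbrsIn switchingSet
  rw [Finset.filter_map, Finset.card_map]
  rfl

theorem card_switchingSet (k : ℕ) : (switchingSet k).card = 2 * k := by
  simp [switchingSet]

theorem inl_mem_switchingSet {k : ℕ} (x : Fin (2 * k)) :
    (.inl x : GammaVertex k) ∈ switchingSet k := by
  simp [switchingSet]

theorem inr_notMem_switchingSet {k : ℕ} (y : Fin (k + 1) ⊕ Fin (3 * k - 1)) :
    (.inr y : GammaVertex k) ∉ switchingSet k := by
  simp [switchingSet]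

theorem nbrsIn_switchingSet_inl {k : ℕ} (x : Fin (2 * k)) :
    nbrsIn (gamma k) (switchingSet k) (.inl x) = 0 := by
  rw [nbrsIn_switchingSet, Finset.card_eq_zero, Finset.filter_eq_empty_iff]
  exact fun _ _ h => h

theorem nbrsIn_switchingSet_inr {k : ℕ} (hk : 2 ≤ k) (y : Fin (k + 1) ⊕ Fin (3 * k - 1)) :
    nbrsIn (gamma k) (switchingSet k) (.inr y) = k := by
  rw [nbrsIn_switchingSet]
  rcases y with u | v
  · exact card_entryN_col hk u
  · exact card_entryM_col hk v

theorem isGMSwitchingSet_switchingSet {k : ℕ} (hk : 2 ≤ k) :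
    IsGMSwitchingSet (gamma k) (switchingSet k) := by
  refine ⟨⟨0, ?_⟩, ?_⟩
  · rintro (x | y) h
    · exact nbrsIn_switchingSet_inl x
    · exact absurd h (inr_notMem_switchingSet y)
  · rintro (x | y) h
    · exact absurd (inl_mem_switchingSet x) h
    · rw [nbrsIn_switchingSet_inr hk, card_switchingSet]
      exact Or.inr (Or.inl rfl)

/-! ### Adjacency after switching. -/

section Switched

variable {k : ℕ}

theorem isFlipped_inl_inr (hk : 2 ≤ k) (x : Fin (2 * k)) (y : Fin (k + 1) ⊕ Fin (3 * k - 1)) :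
    IsFlipped (gamma k) (switchingSet k) (.inl x) (.inr y) :=
  ⟨inl_mem_switchingSet x, inr_notMem_switchingSet y, by
    rw [nbrsIn_switchingSet_inr hk, card_switchingSet]⟩

theorem gmSwitch_adj_inl_inl (x x' : Fin (2 * k)) :
    ¬ (gmSwitch (gamma k) (switchingSet k)).Adj (.inl x) (.inl x') := by
  rintro (⟨h | h, -⟩ | ⟨-, h⟩)
  · exact h.2.1 (inl_mem_switchingSet x')
  · exact h.2.1 (inl_mem_switchingSet x)
  · exact h

theorem gmSwitch_adj_inl_inr (hk : 2 ≤ k) (x : Fin (2 * k))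
    (y : Fin (k + 1) ⊕ Fin (3 * k - 1)) :
    (gmSwitch (gamma k) (switchingSet k)).Adj (.inl x) (.inr y) ↔
      ¬ (gamma k).Adj (.inl x) (.inr y) := by
  have := isFlipped_inl_inr hk x y
  simp only [gmSwitch]
  tauto

theorem gmSwitch_adj_inr_inl (hk : 2 ≤ k) (x : Fin (2 * k))
    (y : Fin (k + 1) ⊕ Fin (3 * k - 1)) :
    (gmSwitch (gamma k) (switchingSet k)).Adj (.inr y) (.inl x) ↔
      ¬ (gamma k).Adj (.inr y) (.inl x) := by
  rw [SimpleGraph.adj_comm, gmSwitch_adj_inl_inr hk, SimpleGraph.adj_comm]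

theorem gmSwitch_adj_inr_inr (y y' : Fin (k + 1) ⊕ Fin (3 * k - 1)) :
    (gmSwitch (gamma k) (switchingSet k)).Adj (.inr y) (.inr y') ↔
      (gamma k).Adj (.inr y) (.inr y') := by
  have h : ∀ y y', ¬ IsFlipped (gamma k) (switchingSet k) (.inr y) (.inr y') :=
    fun y y' h => inr_notMem_switchingSet y h.1
  have h₁ := h y y'
  have h₂ := h y' y
  simp only [gmSwitch]
  tauto

end Switched

theorem degree_eq_card_add_card {α β : Type*} [Fintype α] [Fintype β] (G : SimpleGraph (α ⊕ β))
    [DecidableRel G.Adj] (z : α ⊕ β) :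
    G.degree z = (Finset.univ.filter fun a : α => G.Adj z (.inl a)).card +
      (Finset.univ.filter fun b : β => G.Adj z (.inr b)).card := by
  rw [← SimpleGraph.card_neighborFinset_eq_degree, SimpleGraph.neighborFinset_eq_filter,
    ← Finset.card_toLeft_add_card_toRight]
  congr 2 <;> ext <;> simp

theorem card_filter_sum {α β : Type*} [Fintype α] [Fintype β] (p : α ⊕ β → Prop)
    [DecidablePred p] :
    (Finset.univ.filter p).card = (Finset.univ.filter fun a : α => p (.inl a)).card +
      (Finset.univ.filter fun b : β => p (.inr b)).card := by
  rw [← Finset.card_toLeft_add_card_toRight]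
  congr 2 <;> ext <;> simp

/-! ### Regularity of both graphs. -/

section Regular

variable {k : ℕ}

theorem card_gamma_inl_inr (hk : 2 ≤ k) (x : Fin (2 * k)) :
    (Finset.univ.filter fun y => (gamma k).Adj (.inl x) (.inr y)).card = 2 * k := by
  rw [card_filter_sum]
  exact card_entryN_row_add_card_entryM_row hk x

theorem card_gamma_inr_inl (hk : 2 ≤ k) (y : Fin (k + 1) ⊕ Fin (3 * k - 1)) :
    (Finset.univ.filter fun x => (gamma k).Adj (.inr y) (.inl x)).card = k := by
  rw [← nbrsIn_switchingSet, nbrsIn_switchingSet_inr hk]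

theorem card_gamma_inr_inr (y : Fin (k + 1) ⊕ Fin (3 * k - 1)) :
    (Finset.univ.filter fun y' => (gamma k).Adj (.inr y) (.inr y')).card = k := by
  rw [card_filter_sum]
  rcases y with u | v
  · have h : ∀ v, ¬ (gamma k).Adj (.inr (.inl u)) (.inr (.inr v)) := fun _ => id
    simp only [h, Finset.filter_false, Finset.card_empty]
    exact card_fin_ne u
  · have h : ∀ u, ¬ (gamma k).Adj (.inr (.inr v)) (.inr (.inl u)) := fun _ => id
    simp only [h, Finset.filter_false, Finset.card_empty, zero_add]
    exact card_baseGraph_nbrs v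

theorem gamma_isRegularOfDegree (hk : 2 ≤ k) : (gamma k).IsRegularOfDegree (2 * k) := by
  intro z
  rw [degree_eq_card_add_card]
  rcases z with x | y
  · have h : ∀ x', ¬ (gamma k).Adj (.inl x) (.inl x') := fun _ => id
    simp [card_gamma_inl_inr hk, h]
  · rw [card_gamma_inr_inl hk, card_gamma_inr_inr]
    omega

theorem gmSwitch_isRegularOfDegree (hk : 2 ≤ k) :
    (gmSwitch (gamma k) (switchingSet k)).IsRegularOfDegree (2 * k) := by
  intro z
  rw [degree_eq_card_add_card]
  rcases z with x | y
  · rw [Finset.filter_false_of_mem (fun _ _ => gmSwitch_adj_inl_inl x _)]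
    simp only [gmSwitch_adj_inl_inr hk, Finset.card_empty]
    have h := Finset.card_filter_add_card_filter_not (s := Finset.univ)
      (fun y => (gamma k).Adj (.inl x) (.inr y))
    rw [card_gamma_inl_inr hk, Finset.card_univ, Fintype.card_sum, Fintype.card_fin,
      Fintype.card_fin] at h
    omega
  · simp only [gmSwitch_adj_inr_inl hk, gmSwitch_adj_inr_inr]
    have h := Finset.card_filter_add_card_filter_not (s := Finset.univ)
      (fun x => (gamma k).Adj (.inr y) (.inl x))
    rw [card_gamma_inr_inl hk, Finset.card_univ, Fintype.card_fin] at h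
    rw [card_gamma_inr_inr]
    omega

end Regular

/-! ### Cospectrality. -/

section Spectrum

open Matrix

variable {m n : Type*} [Fintype m] [Fintype n] [DecidableEq m] [DecidableEq n]

/-- Complementing the off-diagonal blocks of a symmetric block matrix, where every column of the
upper block sums to `c` and there are `2 * c` rows, does not change the characteristic
polynomial. -/
theorem charpoly_fromBlocks_complement (c : ℝ) (hc : c ≠ 0) (hm : (Fintype.card m : ℝ) = 2 * c)
    (W : Matrix m n ℝ) (D : Matrix n n ℝ) (hW : ∀ j, ∑ i, W i j = c) :
    (fromBlocks 0 W Wᵀ D).charpoly =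
      (fromBlocks 0 (of fun i j => 1 - W i j) (of fun i j => 1 - W i j)ᵀ D).charpoly := by
  -- `Q = J/c - I`. It squares to the identity because `J² = 2c J`.
  set Q : Matrix m m ℝ := of fun i j => c⁻¹ - (1 : Matrix m m ℝ) i j with hQ
  have hQW : Q * W = of fun i j => 1 - W i j := by
    ext i j
    simp [hQ, Matrix.mul_apply, sub_mul, Finset.sum_sub_distrib, ← Finset.mul_sum, hW, hc,
      Matrix.one_apply]
  have hWQ : Wᵀ * Q = (of fun i j => 1 - W i j)ᵀ := by
    have hQt : Qᵀ = Q := by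
      ext i j
      simp [hQ, Matrix.one_apply, eq_comm]
    rw [← hQW, transpose_mul, hQt]
  have hQQ : Q * Q = 1 := by
    ext i j
    simp [hQ, Matrix.mul_apply, sub_mul, mul_sub, Finset.sum_sub_distrib, Matrix.one_apply, hm]
    field_simp
    split_ifs <;> ring
  set P : Matrix (m ⊕ n) (m ⊕ n) ℝ := fromBlocks Q 0 0 1 with hP
  have hPP : P * P = 1 := by
    simp [hP, fromBlocks_multiply, hQQ]
  have hconj : P * fromBlocks 0 W Wᵀ D * P =
      fromBlocks 0 (of fun i j => 1 - W i j) (of fun i j => 1 - W i j)ᵀ D := by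
    simp [hP, fromBlocks_multiply, hQW, hWQ]
  rw [← hconj, charpoly_mul_comm, ← mul_assoc, hPP, one_mul]

theorem adjSpectrum_gamma_eq {k : ℕ} (hk : 2 ≤ k) :
    adjSpectrum (gamma k) = adjSpectrum (gmSwitch (gamma k) (switchingSet k)) := by
  unfold adjSpectrum
  congr 1
  set A := (gamma k).adjMatrix ℝ with hA
  have h₁ : A = fromBlocks 0 A.toBlocks₁₂ A.toBlocks₁₂ᵀ A.toBlocks₂₂ := by
    ext (x | y) (x' | y')
    · simp only [hA, SimpleGraph.adjMatrix_apply, fromBlocks_apply₁₁, Matrix.zero_apply]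
      exact if_neg fun h => h
    · simp [toBlocks₁₂]
    · simp [toBlocks₁₂, hA, SimpleGraph.adj_comm]
    · simp [toBlocks₂₂]
  have h₂ : (gmSwitch (gamma k) (switchingSet k)).adjMatrix ℝ =
      fromBlocks 0 (of fun i j => 1 - A.toBlocks₁₂ i j) (of fun i j => 1 - A.toBlocks₁₂ i j)ᵀ
        A.toBlocks₂₂ := by
    have hcompl : ∀ (p : Prop) [Decidable p], (if ¬ p then (1 : ℝ) else 0) =
        1 - if p then 1 else 0 := by
      intro p _
      by_cases p <;> simp [*]
    ext (x | y) (x' | y')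
    · simp [gmSwitch_adj_inl_inl]
    · simp only [SimpleGraph.adjMatrix_apply, gmSwitch_adj_inl_inr hk, hcompl]
      simp [toBlocks₁₂, hA]
    · simp only [SimpleGraph.adjMatrix_apply, gmSwitch_adj_inr_inl hk, hcompl]
      simp [toBlocks₁₂, hA, SimpleGraph.adj_comm]
    · simp [toBlocks₂₂, hA, gmSwitch_adj_inr_inr]
  rw [h₂, h₁]
  refine charpoly_fromBlocks_complement (k : ℝ) (by positivity) (by simp) _ _ fun y => ?_
  have h := card_gamma_inr_inl hk y
  simp only [SimpleGraph.adj_comm _ (Sum.inr y)] at h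
  simp [toBlocks₁₂, hA, SimpleGraph.adjMatrix_apply, h]

end Spectrum

/-! ### Lower bounds on connectivity, by labelled disjoint paths. -/

/-- A separation of a graph on `GammaVertex k`, expressed through the labels of the vertices in the
three classes: `SX`, `SU`, `SV` describe fewer than `n` deleted vertices, and `CX`, `CU`, `CV` a set
of remaining vertices whose neighbours all belong to it or are deleted. The relations `N` and `M`
describe the edges between the first class and the other two. -/
structure IsSeparation (k n : ℕ) (N M : ℕ → ℕ → Prop) (SX SU SV CX CU CV : ℕ → Prop) : Prop where
  xu : ∀ {i u}, i < 2 * k → u ≤ k → N i u → CX i → SU u ∨ CU u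
  ux : ∀ {i u}, i < 2 * k → u ≤ k → N i u → CU u → SX i ∨ CX i
  uu : ∀ {u u'}, u ≤ k → u' ≤ k → u ≠ u' → CU u → SU u' ∨ CU u'
  xv : ∀ {i v}, i < 2 * k → v < 3 * k - 1 → M i v → CX i → SV v ∨ CV v
  vx : ∀ {i v}, i < 2 * k → v < 3 * k - 1 → M i v → CV v → SX i ∨ CX i
  vv : ∀ {v v'}, v < 3 * k - 1 → v' < 3 * k - 1 →
    (v + k ≤ v' ∧ v' < v + 2 * k) ∨ (v' + k ≤ v ∧ v < v' + 2 * k) → CV v → SV v' ∨ CV v'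
  lt_of_x : ∀ {i}, CX i → i < 2 * k
  le_of_u : ∀ {u}, CU u → u ≤ k
  lt_of_v : ∀ {v}, CV v → v < 3 * k - 1
  not_u : ∀ {u}, CU u → ¬ SU u
  /-- A labelling of the deleted vertices misses one of `n` labels. -/
  count : ∀ fX fU fV : ℕ → ℕ, ∃ t < n, (∀ i, SX i → fX i ≠ t) ∧ (∀ u, SU u → fU u ≠ t) ∧
    ∀ v, SV v → fV v ≠ t

namespace IsSeparation

variable {k : ℕ} {SX SU SV CX CU CV : ℕ → Prop}

section Gamma

variable (hk : 2 ≤ k)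
  (h : IsSeparation k (2 * k) (entryN k) (entryM k) SX SU SV CX CU CV)

include h

/-- The edge from `x_i` to `u_i` as the end of a path: once `U` is known to avoid `C`, a path
labelled `i` that arrives at `x_i` can be finished at `u_i`. -/
theorem gamma_pair (nU : ∀ u, ¬ CU u) {i t : ℕ} (hi : i ≤ k) (hit : i = t) {fX fU : ℕ → ℕ}
    (hX : ∀ i, SX i → fX i ≠ t) (hU : ∀ u, SU u → fU u ≠ t) (hfX : fX i = i) (hfU : fU i = i) :
    ¬ (SX i ∨ CX i) := by
  rintro (hs | hc)
  · exact hX i hs (hfX.trans hit)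
  · rcases h.xu (by have := h.lt_of_x hc; omega) hi (Or.inl rfl) hc with hs | hc
    · exact hU i hs (hfU.trans hit)
    · exact nU i hc

theorem vx' {i v : ℕ} (hc : CV v) (hi : i < 2 * k)
    (hM : (v = 0 ∧ i ≠ 0 ∧ i ≤ k) ∨ (1 ≤ v ∧ v < k ∧ k ≤ i) ∨
      (v ≠ 0 ∧ k ≤ v ∧ v < 2 * k ∧ i ≠ v - k + 1 ∧ i ≤ k) ∨ (v ≠ 0 ∧ 2 * k ≤ v ∧ i < k)) :
    SX i ∨ CX i :=
  h.vx hi (h.lt_of_v hc) (entryM_iff.2 hM) hc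

theorem xv' {i v : ℕ} (hc : CX i) (hv : v < 3 * k - 1)
    (hM : (v = 0 ∧ i ≠ 0 ∧ i ≤ k) ∨ (1 ≤ v ∧ v < k ∧ k ≤ i) ∨
      (v ≠ 0 ∧ k ≤ v ∧ v < 2 * k ∧ i ≠ v - k + 1 ∧ i ≤ k) ∨ (v ≠ 0 ∧ 2 * k ≤ v ∧ i < k)) :
    SV v ∨ CV v :=
  h.xv (h.lt_of_x hc) hv (entryM_iff.2 hM) hc

/-- If `U` is deleted entirely, fewer than `k - 1` deletions are left, too few to cover the first
`k` vertices of `X`. -/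
theorem gamma_exists_root : (∃ u ≤ k, ¬ SU u) ∨ (∀ u ≤ k, SU u) ∧ ∃ r < k, ¬ SX r := by
  by_contra! hcon
  obtain ⟨t, ht, hX, hU, hV⟩ := h.count (fun i => k + 1 + i) id id
  by_cases htk : t ≤ k
  · exact hU t (hcon.1 t htk) rfl
  · exact hX (t - (k + 1)) (hcon.2 hcon.1 _ (by omega)) (by omega)

include hk

/-- The deletion of `U` uses up the labels `0, …, k`, so `k - 1` disjoint paths, labelled `k + 1, …,
2k - 1`, suffice each time. The root `x_r` is adjacent to every column of `J - K`, and the other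
classes are excluded from there. -/
theorem gamma_of_u_deleted (hSU : ∀ u ≤ k, SU u) {r : ℕ} (hr : r < k) (hrS : ¬ SX r)
    (hrC : ¬ CX r) : (∀ i, ¬ CX i) ∧ (∀ u, ¬ CU u) ∧ ∀ v, ¬ CV v := by
  have nL : ∀ v, 2 * k ≤ v → ¬ CV v := by
    intro v hv hc
    rcases h.vx' (i := r) hc (by omega) (by omega) with hs | hc
    exacts [hrS hs, hrC hc]
  have nX₁ : ∀ i < k, ¬ CX i := by
    intro i hi hc
    obtain ⟨t, ht, hX, hU, hV⟩ := h.count id id (fun v => v - k + 1)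
    by_cases htk : t ≤ k
    · exact hU t (hSU t htk) rfl
    · rcases h.xv' (v := t + k - 1) hc (by omega) (by omega) with hs | hc
      · exact hV _ hs (by omega)
      · exact nL _ (by omega) hc
  have nW : ∀ v, (v = 0 ∨ k ≤ v ∧ v < 2 * k) → ¬ CV v := by
    intro v hv hc
    obtain ⟨j, hj⟩ : ∃ j, (v = 0 ∧ j = 0) ∨ (v ≠ 0 ∧ j = v - k + 1) := by
      by_cases hv0 : v = 0
      exacts [⟨0, by omega⟩, ⟨v - k + 1, by omega⟩]
    -- Column `v` misses row `j`; the labels enumerate the other rows, skipping `j`.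
    obtain ⟨t, ht, hX, hU, hV⟩ := h.count (fun i => if i < j then k + 1 + i else k + i) id id
    by_cases htk : t ≤ k
    · exact hU t (hSU t htk) rfl
    by_cases htj : t - k - 1 < j
    · rcases h.vx' (i := t - k - 1) hc (by omega) (by omega) with hs | hc
      · exact hX _ hs (by rw [if_pos htj]; omega)
      · exact nX₁ _ (by omega) hc
    · rcases h.vx' (i := t - k) hc (by omega) (by omega) with hs | hc
      · exact hX _ hs (by rw [if_neg (by omega)]; omega)
      · exact nX₁ _ (by omega) hc
  have nK : ∀ v, 1 ≤ v → v < k → ¬ CV v := by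
    intro v hv hvk hc
    obtain ⟨t, ht, hX, hU, hV⟩ := h.count id id (fun v' => v' - v + 1)
    by_cases htk : t ≤ k
    · exact hU t (hSU t htk) rfl
    · rcases h.vv (v' := v + t - 1) (by omega) (by omega) (by omega) hc with hs | hc
      · exact hV _ hs (by omega)
      · by_cases hL : 2 * k ≤ v + t - 1
        exacts [nL _ hL hc, nW _ (by omega) hc]
  refine ⟨fun i hc => ?_, fun u hc => h.not_u hc (hSU u (h.le_of_u hc)), fun v hc => ?_⟩
  · have hi := h.lt_of_x hc
    by_cases hik : i < k
    · exact nX₁ i hik hc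
    obtain ⟨t, ht, hX, hU, hV⟩ := h.count id id (fun v => v + k)
    by_cases htk : t ≤ k
    · exact hU t (hSU t htk) rfl
    · rcases h.xv' (v := t - k) hc (by omega) (by omega) with hs | hc
      · exact hV _ hs (by omega)
      · exact nK _ (by omega) (by omega) hc
  · by_cases hL : 2 * k ≤ v
    · exact nL v hL hc
    by_cases hK : 1 ≤ v ∧ v < k
    · exact nK v hK.1 hK.2 hc
    · exact nW v (by omega) hc

/-- A remaining `y > k` in `X` lies outside `C` and is adjacent to all columns of `K`. This excludes
`K`, the starting point for all `2k` paths. -/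
theorem gamma_of_y_remaining (nU : ∀ u, ¬ CU u) (nY : ∀ i, k < i → ¬ CX i) {y : ℕ} (hy : k < y)
    (hy₂ : y < 2 * k) (hyS : ¬ SX y) : (∀ i, ¬ CX i) ∧ ∀ v, ¬ CV v := by
  have nK : ∀ v, 1 ≤ v → v < k → ¬ CV v := by
    intro v hv hvk hc
    rcases h.vx' (i := y) hc hy₂ (by omega) with hs | hc
    exacts [hyS hs, nY y hy hc]
  have nL : ∀ v, 2 * k ≤ v → ¬ CV v := by
    intro v hv hc
    have hvlt := h.lt_of_v hc
    -- For `0 < m < k`, vertices `m` and `k + m` share a label: `v` reaches `m` in `K` either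
    -- directly or through `k + m`. Labels below `k` are the pairs `x_t`, `u_t`, and label `k` is
    -- the path `k`, `x_k`, `u_k`.
    obtain ⟨t, ht, hX, hU, hV⟩ := h.count id id (fun v => if v < k then k + v else v)
    by_cases htk : t < k
    · exact h.gamma_pair nU (by omega) rfl hX hU rfl rfl (h.vx' (i := t) hc (by omega) (by omega))
    have hV' : ∀ m, t = k + m → m < k → ¬ SV m := fun m hm hmk hs =>
      hV m hs (by rw [if_pos hmk]; omega)
    have hV'' : k ≤ t → ¬ SV t := fun hkt hs => hV t hs (by rw [if_neg (by omega)])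
    by_cases htk' : t = k
    · rcases h.vv (v' := t) hvlt (by omega) (by omega) hc with hs | hc
      · exact hV'' (by omega) hs
      · exact h.gamma_pair nU (by omega) rfl hX hU rfl rfl
          (h.vx' (i := t) hc (by omega) (by omega))
    by_cases hm : v < t - k + 2 * k
    · rcases h.vv (v' := t - k) hvlt (by omega) (by omega) hc with hs | hc
      · exact hV' (t - k) (by omega) (by omega) hs
      · exact nK _ (by omega) (by omega) hc
    · rcases h.vv (v' := t) hvlt (by omega) (by omega) hc with hs | hc
      · exact hV'' (by omega) hs
      · rcases h.vv (v' := t - k) (by omega) (by omega) (by omega) hc with hs | hc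
        · exact hV' (t - k) (by omega) (by omega) hs
        · exact nK _ (by omega) (by omega) hc
  have nX₁ : ∀ i < k, ¬ CX i := by
    intro i hi hc
    by_cases hw : ∃ w, k ≤ w ∧ w < 2 * k ∧ CV w
    · obtain ⟨w, hkw, hw2, hcw⟩ := hw
      -- The paths start from both `x_i` and `w`, which lie in `C`: `x_i` supplies the columns of `J
      -- - K`, and `w` the pairs `x_t`, `u_t`. The row `w - k + 1` missed by `w` is reached through
      -- vertex `0`.
      obtain ⟨t, ht, hX, hU, hV⟩ := h.count id id
        (fun v => if v = 0 then w - k + 1 else v - (k - 1))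
      by_cases htk : k < t
      · rcases h.xv' (v := t + k - 1) hc (by omega) (by omega) with hs | hc
        · exact hV _ hs (by rw [if_neg (by omega)]; omega)
        · exact nL _ (by omega) hc
      by_cases htw : t = w - k + 1
      · rcases h.vv (v' := 0) (by omega) (by omega) (by omega) hcw with hs | hc
        · exact hV 0 hs (by rw [if_pos rfl, htw])
        · exact h.gamma_pair nU (by omega) rfl hX hU rfl rfl
            (h.vx' (i := t) hc (by omega) (by omega))
      · exact h.gamma_pair nU (by omega) rfl hX hU rfl rfl
          (h.vx' (i := t) hcw (by omega) (by omega))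
    · push Not at hw
      -- The column `k + i - 1` misses row `i`, so for `i ≠ 0` it is reached from `x_i` through
      -- vertex `0`, and both get label `0`.
      obtain ⟨t, ht, hX, hU, hV⟩ := h.count id id
        (fun v => if v = 0 ∨ v = k + i - 1 then 0 else v - k + 1)
      by_cases hti : t = i
      · exact h.gamma_pair nU (by omega) rfl hX hU rfl rfl (Or.inr (hti ▸ hc))
      by_cases ht0 : t = 0
      · rcases h.xv' (v := 0) hc (by omega) (by omega) with hs | hc
        · exact hV 0 hs (by rw [if_pos (Or.inl rfl), ht0])
        · rcases h.vv (v' := k + i - 1) (by omega) (by omega) (by omega) hc with hs | hc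
          · exact hV _ hs (by rw [if_pos (Or.inr rfl), ht0])
          · exact hw _ (by omega) (by omega) hc
      · rcases h.xv' (v := k + t - 1) hc (by omega) (by omega) with hs | hc
        · exact hV _ hs (by rw [if_neg (by omega)]; omega)
        · by_cases hL : 2 * k ≤ k + t - 1
          exacts [nL _ hL hc, hw _ (by omega) (by omega) hc]
  have nXk : ¬ CX k := by
    intro hc
    by_cases hc0 : CV 0
    · obtain ⟨t, ht, hX, hU, hV⟩ := h.count id id (fun v => if v < k then k + v else 0)
      by_cases htk : k < t
      · rcases h.xv' (v := t - k) hc (by omega) (by omega) with hs | hc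
        · exact hV _ hs (by rw [if_pos (by omega)]; omega)
        · exact nK _ (by omega) (by omega) hc
      by_cases ht0 : t = 0
      · rcases h.xv' (v := k) hc (by omega) (by omega) with hs | hc
        · exact hV _ hs (by rw [if_neg (by omega), ht0])
        · exact h.gamma_pair nU (by omega) rfl hX hU rfl rfl
            (h.vx' (i := t) hc (by omega) (by omega))
      · exact h.gamma_pair nU (by omega) rfl hX hU rfl rfl
            (h.vx' (i := t) hc0 (by omega) (by omega))
    have hs0 : SV 0 := (h.xv' (v := 0) hc (by omega) (by omega)).resolve_right hc0
    by_cases hw : ∃ w, k ≤ w ∧ w < 2 * k - 1 ∧ CV w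
    · obtain ⟨w, hkw, hw2, hcw⟩ := hw
      -- Vertex `0` is deleted here, so it can absorb the label of the row that `w` misses.
      obtain ⟨t, ht, hX, hU, hV⟩ := h.count id id (fun v => if v = 0 then w - k + 1 else k + v)
      by_cases htk : k < t
      · rcases h.xv' (v := t - k) hc (by omega) (by omega) with hs | hc
        · exact hV _ hs (by rw [if_neg (by omega)]; omega)
        · exact nK _ (by omega) (by omega) hc
      by_cases htw : t = w - k + 1
      · exact hV 0 hs0 (by rw [if_pos rfl, htw])
      · exact h.gamma_pair nU (by omega) rfl hX hU rfl rfl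
            (h.vx' (i := t) hcw (by omega) (by omega))
    · push Not at hw
      obtain ⟨t, ht, hX, hU, hV⟩ := h.count id id
        (fun v => if v = 0 then 0 else if v < k then k + v else v - k + 1)
      by_cases htk : k < t
      · rcases h.xv' (v := t - k) hc (by omega) (by omega) with hs | hc
        · exact hV _ hs (by rw [if_neg (by omega), if_pos (by omega)]; omega)
        · exact nK _ (by omega) (by omega) hc
      by_cases ht0 : t = 0
      · exact hV 0 hs0 (by rw [if_pos rfl, ht0])
      by_cases htk' : t = k
      · exact h.gamma_pair nU le_rfl htk'.symm hX hU rfl rfl (Or.inr hc)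
      · rcases h.xv' (v := k + t - 1) hc (by omega) (by omega) with hs | hc
        · exact hV _ hs (by rw [if_neg (by omega), if_neg (by omega)]; omega)
        · exact hw _ (by omega) (by omega) hc
  have nX : ∀ i, ¬ CX i := by
    intro i hc
    rcases lt_trichotomy i k with hi | rfl | hi
    exacts [nX₁ i hi hc, nXk hc, nY i hi hc]
  have nW : ∀ v, k ≤ v → v < 2 * k → ¬ CV v := by
    intro v hkv hv2 hc
    obtain ⟨t, ht, hX, hU, hV⟩ := h.count id id
      (fun v' => if v' = 0 then v - k + 1 else if v' < k then k + v' else v' - k + 1)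
    by_cases htk : k < t
    · by_cases htv : t ≤ v
      · rcases h.vv (v' := t - k) (by omega) (by omega) (by omega) hc with hs | hc
        · exact hV _ hs (by rw [if_neg (by omega), if_pos (by omega)]; omega)
        · exact nK _ (by omega) (by omega) hc
      · rcases h.vv (v' := t + k - 1) (by omega) (by omega) (by omega) hc with hs | hc
        · exact hV _ hs (by rw [if_neg (by omega), if_neg (by omega)]; omega)
        · exact nL _ (by omega) hc
    have hx : ¬ (SX t ∨ CX t) := by
      rintro (hs | hc)
      exacts [hX t hs rfl, nX t hc]
    by_cases htv : t = v - k + 1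
    · rcases h.vv (v' := 0) (by omega) (by omega) (by omega) hc with hs | hc
      · exact hV 0 hs (by rw [if_pos rfl, htv])
      · exact hx (h.vx' hc (by omega) (by omega))
    · exact hx (h.vx' hc (by omega) (by omega))
  refine ⟨nX, fun v hc => ?_⟩
  by_cases hL : 2 * k ≤ v
  · exact nL v hL hc
  by_cases hkv : k ≤ v
  · exact nW v hkv (by omega) hc
  by_cases hv0 : v ≠ 0
  · exact nK v (by omega) (by omega) hc
  obtain ⟨t, ht, hX, hU, hV⟩ := h.count (fun i => i - 1) id id
  by_cases htk : t < k
  · rcases h.vx' (i := t + 1) hc (by omega) (by omega) with hs | hc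
    exacts [hX _ hs rfl, nX _ hc]
  · rcases h.vv (v' := t) (by omega) (by omega) (by omega) hc with hs | hc
    exacts [hV _ hs rfl, nW _ (by omega) (by omega) hc]

/-- The `k - 1` deleted vertices of `X` beyond `k` use up the labels `k + 1, …, 2k - 1`, so `k + 1`
disjoint paths suffice, mostly ending in the pairs `x_t`, `u_t`. -/
theorem gamma_of_y_deleted (nU : ∀ u, ¬ CU u) (nY : ∀ i, k < i → ¬ CX i)
    (hSY : ∀ i, k < i → i < 2 * k → SX i) : (∀ i, ¬ CX i) ∧ ∀ v, ¬ CV v := by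
  have nW₁ : ∀ v, k ≤ v → v < 2 * k → ¬ CV v := by
    intro v hkv hv2 hc
    obtain ⟨t, ht, hX, hU, hV⟩ := h.count id id (fun _ => v - k + 1)
    by_cases htk : k < t
    · exact hX t (hSY t htk ht) rfl
    by_cases htv : t = v - k + 1
    · rcases h.vv (v' := 0) (by omega) (by omega) (by omega) hc with hs | hc
      · exact hV 0 hs htv.symm
      · exact h.gamma_pair nU (by omega) rfl hX hU rfl rfl
            (h.vx' (i := t) hc (by omega) (by omega))
    · exact h.gamma_pair nU (by omega) rfl hX hU rfl rfl
            (h.vx' (i := t) hc (by omega) (by omega))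
  have nW₀ : ¬ CV 0 := by
    intro hc
    obtain ⟨t, ht, hX, hU, hV⟩ := h.count id id (fun _ => 0)
    by_cases htk : k < t
    · exact hX t (hSY t htk ht) rfl
    by_cases ht0 : t = 0
    · rcases h.vv (v' := k) (by omega) (by omega) (by omega) hc with hs | hc
      exacts [hV _ hs ht0.symm, nW₁ k le_rfl (by omega) hc]
    · exact h.gamma_pair nU (by omega) rfl hX hU rfl rfl
            (h.vx' (i := t) hc (by omega) (by omega))
  have nL : ∀ v, 2 * k ≤ v → ¬ CV v := by
    intro v hv hc
    have hvlt := h.lt_of_v hc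
    obtain ⟨t, ht, hX, hU, hV⟩ := h.count id id (fun _ => k)
    by_cases htk : k < t
    · exact hX t (hSY t htk ht) rfl
    by_cases htk' : t = k
    · rcases h.vv (v' := k) (by omega) (by omega) (by omega) hc with hs | hc
      exacts [hV _ hs htk'.symm, nW₁ k le_rfl (by omega) hc]
    · exact h.gamma_pair nU (by omega) rfl hX hU rfl rfl
            (h.vx' (i := t) hc (by omega) (by omega))
  have nX : ∀ i, ¬ CX i := by
    intro i hc
    by_cases hi : k < i
    · exact nY i hi hc
    obtain ⟨t, ht, hX, hU, hV⟩ := h.count id id (fun v => if v = 0 then 0 else v - k + 1)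
    by_cases htk : k < t
    · exact hX t (hSY t htk ht) rfl
    by_cases hti : t = i
    · exact h.gamma_pair nU (by omega) rfl hX hU rfl rfl (Or.inr (hti ▸ hc))
    by_cases ht0 : t = 0
    · rcases h.xv' (v := 0) hc (by omega) (by omega) with hs | hc
      exacts [hV _ hs ht0.symm, nW₀ hc]
    · rcases h.xv' (v := k + t - 1) hc (by omega) (by omega) with hs | hc
      · exact hV _ hs (by rw [if_neg (by omega)]; omega)
      · exact nW₁ _ (by omega) (by omega) hc
  refine ⟨nX, fun v hc => ?_⟩
  by_cases hL : 2 * k ≤ v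
  · exact nL v hL hc
  by_cases hkv : k ≤ v
  · exact nW₁ v hkv (by omega) hc
  by_cases hv0 : v = 0
  · exact nW₀ (hv0 ▸ hc)
  obtain ⟨t, ht, hX, hU, hV⟩ := h.count id id (fun v' => v' - (v + k))
  by_cases htk : k < t
  · exact hX t (hSY t htk ht) rfl
  by_cases htk' : t = k
  · rcases h.vx' (i := t) hc (by omega) (by omega) with hs | hc
    exacts [hX _ hs rfl, nX _ hc]
  · rcases h.vv (v' := v + k + t) (by omega) (by omega) (by omega) hc with hs | hc
    · exact hV _ hs (by omega)
    · by_cases hL : 2 * k ≤ v + k + t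
      exacts [nL _ hL hc, nW₁ _ (by omega) (by omega) hc]

/-- `U` is a clique, and every vertex of `X` beyond `k` is adjacent to all of it; both therefore
avoid `C`. -/
theorem gamma_of_u_remaining {r : ℕ} (hr : r ≤ k) (hrS : ¬ SU r) (hrC : ¬ CU r) :
    (∀ i, ¬ CX i) ∧ (∀ u, ¬ CU u) ∧ ∀ v, ¬ CV v := by
  have nU : ∀ u, ¬ CU u := by
    intro u hc
    by_cases hur : u = r
    · exact hrC (hur ▸ hc)
    · rcases h.uu (h.le_of_u hc) hr hur hc with hs | hc
      exacts [hrS hs, hrC hc]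
  have nY : ∀ i, k < i → ¬ CX i := by
    intro i hi hc
    rcases h.xu (h.lt_of_x hc) hr (Or.inr hi) hc with hs | hc
    exacts [hrS hs, hrC hc]
  have key : (∀ i, ¬ CX i) ∧ ∀ v, ¬ CV v := by
    by_cases hSY : ∀ i, k < i → i < 2 * k → SX i
    · exact h.gamma_of_y_deleted hk nU nY hSY
    · push Not at hSY
      obtain ⟨y, hy, hy₂, hyS⟩ := hSY
      exact h.gamma_of_y_remaining hk nU nY hy hy₂ hyS
  exact ⟨key.1, nU, key.2⟩

end Gamma

/-! ### The lower bound `k + 1` for the switched graph. -/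

section Switched

variable (hk : 2 ≤ k)
  (h : IsSeparation k (k + 1) (fun i u => ¬ entryN k i u) (fun i v => ¬ entryM k i v)
    SX SU SV CX CU CV)

include h

theorem switched_vx {i v : ℕ} (hc : CV v) (hi : i < 2 * k)
    (hM : (v = 0 ∧ (i = 0 ∨ k < i)) ∨ (1 ≤ v ∧ v < k ∧ i < k) ∨
      (v ≠ 0 ∧ k ≤ v ∧ v < 2 * k ∧ (i = v - k + 1 ∨ k < i)) ∨ (v ≠ 0 ∧ 2 * k ≤ v ∧ k ≤ i)) :
    SX i ∨ CX i :=
  h.vx hi (h.lt_of_v hc) (by rw [entryM_iff]; omega) hc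

theorem switched_xv {i v : ℕ} (hc : CX i) (hv : v < 3 * k - 1)
    (hM : (v = 0 ∧ (i = 0 ∨ k < i)) ∨ (1 ≤ v ∧ v < k ∧ i < k) ∨
      (v ≠ 0 ∧ k ≤ v ∧ v < 2 * k ∧ (i = v - k + 1 ∨ k < i)) ∨ (v ≠ 0 ∧ 2 * k ≤ v ∧ k ≤ i)) :
    SV v ∨ CV v :=
  h.xv (h.lt_of_x hc) hv (by rw [entryM_iff]; omega) hc

theorem switched_exists_root : ∃ u ≤ k, ¬ SU u := by
  by_contra! hcon
  obtain ⟨t, ht, hX, hU, hV⟩ := h.count id id id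
  exact hU t (hcon t (by omega)) rfl

include hk

/-- After switching, `x_i` with `i ≤ k` is adjacent to every `u ≠ i`. If it were in `C`, these `k`
vertices would be all of `S`; a short walk would then bring a second such `x_j` into `C` and force
`u_i` to be deleted too. The other classes follow with `k + 1` disjoint paths each. -/
theorem switched_of_u_remaining {r : ℕ} (hr : r ≤ k) (hrS : ¬ SU r) (hrC : ¬ CU r) :
    (∀ i, ¬ CX i) ∧ (∀ u, ¬ CU u) ∧ ∀ v, ¬ CV v := by
  have nU : ∀ u, ¬ CU u := by
    intro u hc
    by_cases hur : u = r
    · exact hrC (hur ▸ hc)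
    · rcases h.uu (h.le_of_u hc) hr hur hc with hs | hc
      exacts [hrS hs, hrC hc]
  have hxu : ∀ i u, CX i → i ≤ k → u ≤ k → u ≠ i → SU u := fun i u hc hi hu hui =>
    (h.xu (h.lt_of_x hc) hu (by unfold entryN; omega) hc).resolve_right (nU u)
  have nX₁ : ∀ i ≤ k, ¬ CX i := by
    intro i hi hc
    -- Every label but `i` belongs to a deleted vertex of `U`, so the missed label is `i`: nothing
    -- in `X` or `V` is deleted, nor is `u_i`.
    obtain ⟨t, ht, hX, hU, hV⟩ := h.count (fun _ => i) id (fun _ => i)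
    by_cases hti : t ≠ i
    · exact hU t (hxu i t hc hi (by omega) hti) rfl
    push Not at hti
    have hX' : ∀ i, ¬ SX i := fun i hs => hX i hs hti.symm
    have hV' : ∀ v, ¬ SV v := fun v hs => hV v hs hti.symm
    by_cases hik : i < k
    · have hc₁ := (h.switched_xv (v := 1) hc (by omega) (by omega)).resolve_left (hV' _)
      obtain ⟨j, hj, hji⟩ : ∃ j < 2, j ≠ i := by
        by_cases hi0 : i = 0
        exacts [⟨1, by omega⟩, ⟨0, by omega⟩]
      have hc₂ := (h.switched_vx (i := j) hc₁ (by omega) (by omega)).resolve_left (hX' _)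
      exact hU i (hxu j i hc₂ (by omega) hi hji.symm) hti.symm
    · have hc₁ := (h.switched_xv (v := 2 * k) hc (by omega) (by omega)).resolve_left (hV' _)
      have hc₂ := (h.switched_vx (i := k + 1) hc₁ (by omega) (by omega)).resolve_left (hX' _)
      have hc₃ := (h.switched_xv (v := 0) hc₂ (by omega) (by omega)).resolve_left (hV' _)
      have hc₄ := (h.switched_vx (i := 0) hc₃ (by omega) (by omega)).resolve_left (hX' _)
      exact hU i (hxu 0 i hc₄ (by omega) hi (by omega)) hti.symm
  have nK : ∀ v, 1 ≤ v → v < k → ¬ CV v := by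
    intro v hv hvk hc
    obtain ⟨t, ht, hX, hU, hV⟩ := h.count id id (fun _ => k)
    have hx : ¬ (SX t ∨ CX t) := by
      rintro (hs | hc)
      exacts [hX t hs rfl, nX₁ t (by omega) hc]
    by_cases htk : t < k
    · exact hx (h.switched_vx hc (by omega) (by omega))
    · rcases h.vv (v' := 2 * k - 1) (by omega) (by omega) (by omega) hc with hs | hc
      · exact hV _ hs (by omega)
      · exact hx (h.switched_vx hc (by omega) (by omega))
  have nX : ∀ i, ¬ CX i := by
    intro i hc
    by_cases hi : i ≤ k
    · exact nX₁ i hi hc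
    obtain ⟨t, ht, hX, hU, hV⟩ := h.count id id (fun v => if v = 0 then 0 else v - k + 1)
    have hx : ¬ (SX t ∨ CX t) := by
      rintro (hs | hc)
      exacts [hX t hs rfl, nX₁ t (by omega) hc]
    by_cases ht0 : t = 0
    · rcases h.switched_xv (v := 0) hc (by omega) (by omega) with hs | hc
      · exact hV _ hs ht0.symm
      · exact hx (h.switched_vx hc (by omega) (by omega))
    · rcases h.switched_xv (v := k + t - 1) hc (by omega) (by omega) with hs | hc
      · exact hV _ hs (by rw [if_neg (by omega)]; omega)
      · exact hx (h.switched_vx hc (by omega) (by omega))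
  have nW : ∀ v, (v = 0 ∨ k ≤ v ∧ v < 2 * k) → ¬ CV v := by
    intro v hv hc
    obtain ⟨j, hj⟩ : ∃ j, (v = 0 ∧ j = 0) ∨ (v ≠ 0 ∧ j = v - k + 1) := by
      by_cases hv0 : v = 0
      exacts [⟨0, by omega⟩, ⟨v - k + 1, by omega⟩]
    -- A second column `w`, adjacent to `v` in the base graph, whose row `m` differs from `j`; it
    -- supplies the path `w`, `x_m`.
    obtain ⟨m, w, hmw⟩ : ∃ m w, (j = 0 ∧ m = 1 ∧ w = k) ∨ (j ≠ 0 ∧ m = 0 ∧ w = 0) := by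
      by_cases hj0 : j = 0
      exacts [⟨1, k, by omega⟩, ⟨0, 0, by omega⟩]
    obtain ⟨t, ht, hX, hU, hV⟩ := h.count
      (fun i => if k < i then i - (k + 1) else if i = j then k - 1 else k) id (fun _ => k)
    by_cases htk : t < k - 1
    · rcases h.switched_vx (i := t + k + 1) hc (by omega) (by omega) with hs | hc
      · exact hX _ hs (by rw [if_pos (by omega)]; omega)
      · exact nX _ hc
    by_cases htk' : t = k - 1
    · rcases h.switched_vx (i := j) hc (by omega) (by omega) with hs | hc
      · exact hX _ hs (by rw [if_neg (by omega), if_pos rfl, htk'])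
      · exact nX _ hc
    · rcases h.vv (v' := w) (by omega) (by omega) (by omega) hc with hs | hc
      · exact hV _ hs (by omega)
      · rcases h.switched_vx (i := m) hc (by omega) (by omega) with hs | hc
        · exact hX _ hs (by rw [if_neg (by omega), if_neg (by omega)]; omega)
        · exact nX _ hc
  refine ⟨nX, nU, fun v hc => ?_⟩
  by_cases hK : 1 ≤ v ∧ v < k
  · exact nK v hK.1 hK.2 hc
  by_cases hL : v < 2 * k
  · exact nW v (by omega) hc
  have hvlt := h.lt_of_v hc
  obtain ⟨t, ht, hX, hU, hV⟩ := h.count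
    (fun i => if k < i then i - (k + 1) else k - 1) id (fun _ => k)
  by_cases htk : t < k - 1
  · rcases h.switched_vx (i := t + k + 1) hc (by omega) (by omega) with hs | hc
    · exact hX _ hs (by rw [if_pos (by omega)]; omega)
    · exact nX _ hc
  by_cases htk' : t = k - 1
  · rcases h.switched_vx (i := k) hc (by omega) (by omega) with hs | hc
    · exact hX _ hs (by rw [if_neg (by omega), htk'])
    · exact nX _ hc
  · rcases h.vv (v' := k) (by omega) (by omega) (by omega) hc with hs | hc
    · exact hV _ hs (by omega)
    · exact nW k (by omega) hc

end Switched

end IsSeparation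

/-! ### From closed sets to vertex-connectivity. -/

/-- The hypothesis is applied to the set of remaining vertices not reachable from `r`. The second
vertex `r'` only rules out the clause on at most one remaining vertex. -/
theorem not_isSeparating_of_closed {V : Type*} {G : SimpleGraph V} {S : Finset V} {r r' : V}
    (hr : r ∉ S) (hr' : r' ∉ S) (hne : r ≠ r')
    (h : ∀ C : V → Prop, ¬ C r → (∀ a, C a → a ∉ S) →
      (∀ a b, G.Adj a b → C a → b ∈ S ∨ C b) → ∀ a, ¬ C a) : ¬ IsSeparating G S := by
  rintro (hS | hS)
  · refine hS fun a b => ?_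
    have key : ∀ a : {v | v ∉ S}, (G.induce {v | v ∉ S}).Reachable ⟨r, hr⟩ a := by
      rintro ⟨a, ha⟩
      by_contra hcon
      refine h (fun a => ∃ ha : a ∉ S, ¬ (G.induce {v | v ∉ S}).Reachable ⟨r, hr⟩ ⟨a, ha⟩)
        (fun ⟨_, h⟩ => h (SimpleGraph.Reachable.refl _)) (fun _ h => h.1) ?_ a ⟨ha, hcon⟩
      rintro a b hab ⟨ha, hra⟩
      by_cases hb : b ∈ S
      · exact Or.inl hb
      · refine Or.inr ⟨hb, fun hrb => hra (hrb.trans (SimpleGraph.Adj.reachable ?_))⟩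
        exact hab.symm
    exact (key a).symm.trans (key b)
  · exact hne (hS hr hr')

theorem isSeparating_of_closed {V : Type*} {G : SimpleGraph V} {S : Finset V} {a b : V}
    (ha : a ∉ S) (hb : b ∉ S) (C : V → Prop) (hCa : C a) (hCb : ¬ C b)
    (h : ∀ v w, G.Adj v w → C v → w ∈ S ∨ C w) : IsSeparating G S := by
  refine Or.inl fun hcon => hCb ?_
  obtain ⟨p⟩ := hcon ⟨a, ha⟩ ⟨b, hb⟩
  have key : ∀ v w : {v | v ∉ S}, (G.induce {v | v ∉ S}).Walk v w → C v → C w := by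
    intro v w p
    induction p with
    | nil => exact id
    | @cons v w _ hvw _ ih =>
      exact fun hv => ih ((h v w hvw hv).resolve_left w.2)
  exact key _ _ p hCa

theorem vertexConnectivity_eq {V : Type*} [Fintype V] {G : SimpleGraph V} {n : ℕ} {S : Finset V}
    (hS : S.card = n) (hsep : IsSeparating G S) (h : ∀ T : Finset V, T.card < n →
      ¬ IsSeparating G T) : vertexConnectivity G = n := by
  have hleast := isLeast_vertexConnectivity G
  obtain ⟨T, hT, hTsep⟩ := hleast.1
  exact le_antisymm (hleast.2 ⟨S, hS, hsep⟩) (not_lt.1 fun hlt => h T (hT ▸ hlt) hTsep)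

theorem exists_pair_notMem {α : Type*} [Fintype α] {S : Finset α} (r : α)
    (hcard : S.card + 1 < Fintype.card α) : ∃ r' ∉ S, r ≠ r' := by
  classical
  have hlt : (insert r S).card < Fintype.card α :=
    lt_of_le_of_lt (Finset.card_insert_le r S) hcard
  by_contra! hcon
  refine hlt.ne (congrArg Finset.card (Finset.eq_univ_iff_forall.2 fun x => ?_))
  by_cases hx : x ∈ S
  · exact Finset.mem_insert_of_mem hx
  · rw [hcon x hx]; exact Finset.mem_insert_self x S

/-- The vertex labelled `i` in the first class has property `p`. -/
def OnX {k : ℕ} (p : GammaVertex k → Prop) (i : ℕ) : Prop := ∃ hi : i < 2 * k, p (.inl ⟨i, hi⟩)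

/-- The vertex labelled `u` in the second class has property `p`. -/
def OnU {k : ℕ} (p : GammaVertex k → Prop) (u : ℕ) : Prop :=
  ∃ hu : u < k + 1, p (.inr (.inl ⟨u, hu⟩))

/-- The vertex labelled `v` in the third class has property `p`. -/
def OnV {k : ℕ} (p : GammaVertex k → Prop) (v : ℕ) : Prop :=
  ∃ hv : v < 3 * k - 1, p (.inr (.inr ⟨v, hv⟩))

section Separation

variable {k n : ℕ} {N M : ℕ → ℕ → Prop} {G : SimpleGraph (GammaVertex k)}

theorem isSeparation_of_closed
    (hxu : ∀ (x : Fin (2 * k)) (u : Fin (k + 1)), G.Adj (.inl x) (.inr (.inl u)) ↔ N x u)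
    (hxv : ∀ (x : Fin (2 * k)) (v : Fin (3 * k - 1)), G.Adj (.inl x) (.inr (.inr v)) ↔ M x v)
    (hrr : ∀ y y', G.Adj (.inr y) (.inr y') ↔ (gamma k).Adj (.inr y) (.inr y'))
    {S : Finset (GammaVertex k)} (hS : S.card < n) {C : GammaVertex k → Prop}
    (hCS : ∀ a, C a → a ∉ S) (hC : ∀ a b, G.Adj a b → C a → b ∈ S ∨ C b) :
    IsSeparation k n N M (OnX (· ∈ S)) (OnU (· ∈ S)) (OnV (· ∈ S)) (OnX C) (OnU C) (OnV C) where
  xu := by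
    rintro i u hi hu hN ⟨_, hc⟩
    exact (hC _ (.inr (.inl ⟨u, Nat.lt_succ_of_le hu⟩)) ((hxu _ _).2 hN) hc).imp
      (fun h => ⟨_, h⟩) (fun h => ⟨_, h⟩)
  ux := by
    rintro i u hi hu hN ⟨_, hc⟩
    exact (hC _ (.inl ⟨i, hi⟩) ((hxu _ _).2 hN).symm hc).imp
      (fun h => ⟨_, h⟩) (fun h => ⟨_, h⟩)
  uu := by
    rintro u u' hu hu' hne ⟨_, hc⟩
    refine (hC _ (.inr (.inl ⟨u', Nat.lt_succ_of_le hu'⟩)) ((hrr _ _).2 ?_) hc).imp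
      (fun h => ⟨_, h⟩) (fun h => ⟨_, h⟩)
    exact fun h => hne (congrArg Fin.val h)
  xv := by
    rintro i v hi hv hM ⟨_, hc⟩
    exact (hC _ (.inr (.inr ⟨v, hv⟩)) ((hxv _ _).2 hM) hc).imp
      (fun h => ⟨_, h⟩) (fun h => ⟨_, h⟩)
  vx := by
    rintro i v hi hv hM ⟨_, hc⟩
    exact (hC _ (.inl ⟨i, hi⟩) ((hxv _ _).2 hM).symm hc).imp
      (fun h => ⟨_, h⟩) (fun h => ⟨_, h⟩)
  vv := by
    rintro v v' hv hv' hadj ⟨_, hc⟩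
    refine (hC _ (.inr (.inr ⟨v', hv'⟩)) ((hrr _ _).2 ?_) hc).imp
      (fun h => ⟨_, h⟩) (fun h => ⟨_, h⟩)
    exact (baseGraph_adj_iff _ _).2 hadj
  lt_of_x := fun h => h.1
  le_of_u := fun h => Nat.le_of_lt_succ h.1
  lt_of_v := fun h => h.1
  not_u := fun ⟨_, h⟩ ⟨_, hs⟩ => hCS _ h hs
  count := by
    intro fX fU fV
    let f : GammaVertex k → ℕ := Sum.elim (fun x => fX x) (Sum.elim (fun u => fU u) fun v => fV v)
    obtain ⟨t, ht, htS⟩ : ∃ t ∈ Finset.range n, t ∉ S.image f := by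
      refine Finset.exists_mem_notMem_of_card_lt_card ?_
      rw [Finset.card_range]
      exact lt_of_le_of_lt Finset.card_image_le hS
    refine ⟨t, Finset.mem_range.1 ht, ?_, ?_, ?_⟩
    all_goals
      rintro i ⟨hi, hs⟩ rfl
      exact htS (Finset.mem_image_of_mem f hs)

theorem forall_not_of_onX_onU_onV {C : GammaVertex k → Prop}
    (h : (∀ i, ¬ OnX C i) ∧ (∀ u, ¬ OnU C u) ∧ ∀ v, ¬ OnV C v) (a : GammaVertex k) : ¬ C a := by
  rcases a with x | u | v
  · exact fun hc => h.1 x ⟨x.2, hc⟩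
  · exact fun hc => h.2.1 u ⟨u.2, hc⟩
  · exact fun hc => h.2.2 v ⟨v.2, hc⟩

end Separation

/-! ### The two connectivity values. -/

section Connectivity

variable {k : ℕ}

theorem card_gammaVertex (hk : 2 ≤ k) : Fintype.card (GammaVertex k) = 6 * k := by
  simp only [Fintype.card_sum, Fintype.card_fin]
  omega

theorem isSeparation_gamma {S : Finset (GammaVertex k)} (hS : S.card < 2 * k)
    {C : GammaVertex k → Prop} (hCS : ∀ a, C a → a ∉ S)
    (hC : ∀ a b, (gamma k).Adj a b → C a → b ∈ S ∨ C b) :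
    IsSeparation k (2 * k) (entryN k) (entryM k) (OnX (· ∈ S)) (OnU (· ∈ S)) (OnV (· ∈ S))
      (OnX C) (OnU C) (OnV C) :=
  isSeparation_of_closed (fun _ _ => Iff.rfl) (fun _ _ => Iff.rfl) (fun _ _ => Iff.rfl) hS hCS hC

theorem isSeparation_gmSwitch (hk : 2 ≤ k) {S : Finset (GammaVertex k)} (hS : S.card < k + 1)
    {C : GammaVertex k → Prop} (hCS : ∀ a, C a → a ∉ S)
    (hC : ∀ a b, (gmSwitch (gamma k) (switchingSet k)).Adj a b → C a → b ∈ S ∨ C b) :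
    IsSeparation k (k + 1) (fun i u => ¬ entryN k i u) (fun i v => ¬ entryM k i v)
      (OnX (· ∈ S)) (OnU (· ∈ S)) (OnV (· ∈ S)) (OnX C) (OnU C) (OnV C) :=
  isSeparation_of_closed (fun _ _ => gmSwitch_adj_inl_inr hk _ _)
    (fun _ _ => gmSwitch_adj_inl_inr hk _ _) gmSwitch_adj_inr_inr hS hCS hC

theorem vertexConnectivity_gamma (hk : 2 ≤ k) : vertexConnectivity (gamma k) = 2 * k := by
  let u₀ : GammaVertex k := .inr (.inl 0)
  let v₀ : GammaVertex k := .inr (.inr ⟨0, by omega⟩)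
  refine vertexConnectivity_eq (S := (gamma k).neighborFinset u₀)
    ((SimpleGraph.card_neighborFinset_eq_degree _ _).trans (gamma_isRegularOfDegree hk u₀)) ?_
    fun S hS => ?_
  · refine isSeparating_of_closed (a := u₀) (b := v₀) ?_ ?_ (· = u₀) rfl ?_ ?_
    · simp
    · rw [SimpleGraph.mem_neighborFinset]
      exact id
    · simp [u₀, v₀]
    · rintro v w hvw rfl
      exact Or.inl ((SimpleGraph.mem_neighborFinset _ _ _).2 hvw)
  · have hcard := card_gammaVertex hk
    -- With `C` empty only the counting of deleted vertices is left; it yields the root before any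
    -- component is chosen.
    have h₀ := isSeparation_gamma hS (C := fun _ => False) (fun _ h => h.elim)
      (fun _ _ _ h => h.elim)
    rcases h₀.gamma_exists_root with ⟨u, hu, huS⟩ | ⟨hSU, r, hr, hrS⟩
    · have hrS : (.inr (.inl ⟨u, by omega⟩) : GammaVertex k) ∉ S := fun h => huS ⟨_, h⟩
      obtain ⟨r', hr', hne⟩ := exists_pair_notMem (S := S) (.inr (.inl ⟨u, by omega⟩)) (by omega)
      refine not_isSeparating_of_closed hrS hr' hne fun C hCr hCS hC => ?_
      exact forall_not_of_onX_onU_onV ((isSeparation_gamma hS hCS hC).gamma_of_u_remaining hk hu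
        huS fun ⟨_, h⟩ => hCr h)
    · have hrS' : (.inl ⟨r, by omega⟩ : GammaVertex k) ∉ S := fun h => hrS ⟨_, h⟩
      obtain ⟨r', hr', hne⟩ := exists_pair_notMem (S := S) (.inl ⟨r, by omega⟩) (by omega)
      refine not_isSeparating_of_closed hrS' hr' hne fun C hCr hCS hC => ?_
      exact forall_not_of_onX_onU_onV ((isSeparation_gamma hS hCS hC).gamma_of_u_deleted hk hSU hr
        hrS fun ⟨_, h⟩ => hCr h)

theorem vertexConnectivity_gmSwitch (hk : 2 ≤ k) :
    vertexConnectivity (gmSwitch (gamma k) (switchingSet k)) = k + 1 := by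
  let u₀ : GammaVertex k := .inr (.inl 0)
  let v₀ : GammaVertex k := .inr (.inr ⟨0, by omega⟩)
  -- These `k + 1` vertices are the only ones of `X` still adjacent to `U` after switching.
  let S₀ : Finset (GammaVertex k) :=
    (Finset.univ.filter fun x : Fin (2 * k) => (x : ℕ) ≤ k).map Function.Embedding.inl
  have hS₀r : ∀ y, (.inr y : GammaVertex k) ∉ S₀ := by simp [S₀]
  refine vertexConnectivity_eq (S := S₀) ?_ ?_ fun S hS => ?_
  · rw [Finset.card_map, card_fin_filter_eq _ (Finset.range (k + 1)), Finset.card_range]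
    · intro i hi
      rw [Finset.mem_range] at hi
      omega
    · intro i
      rw [Finset.mem_range]
      omega
  · refine isSeparating_of_closed (a := u₀) (b := v₀) (hS₀r _) (hS₀r _)
      (∃ u, · = Sum.inr (Sum.inl u)) ⟨0, rfl⟩ (by simp [v₀]) ?_
    rintro _ w hvw ⟨u, rfl⟩
    rcases w with x | u' | v
    · rw [gmSwitch_adj_inr_inl hk] at hvw
      have hx : ¬ entryN k x u := hvw
      refine Or.inl ?_
      unfold entryN at hx
      simp only [S₀, Finset.mem_map, Finset.mem_filter, Finset.mem_univ, true_and,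
        Function.Embedding.inl_apply, Sum.inl.injEq, exists_eq_right]
      omega
    · exact Or.inr ⟨u', rfl⟩
    · exact ((gmSwitch_adj_inr_inr _ _).1 hvw).elim
  · have hcard := card_gammaVertex hk
    have h₀ := isSeparation_gmSwitch hk hS (C := fun _ => False) (fun _ h => h.elim)
      (fun _ _ _ h => h.elim)
    obtain ⟨u, hu, huS⟩ := h₀.switched_exists_root
    have hrS : (.inr (.inl ⟨u, by omega⟩) : GammaVertex k) ∉ S := fun h => huS ⟨_, h⟩
    obtain ⟨r', hr', hne⟩ := exists_pair_notMem (S := S) (.inr (.inl ⟨u, by omega⟩)) (by omega)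
    refine not_isSeparating_of_closed hrS hr' hne fun C hCr hCS hC => ?_
    exact forall_not_of_onX_onU_onV ((isSeparation_gmSwitch hk hS hCS hC).switched_of_u_remaining
      hk hu huS fun ⟨_, h⟩ => hCr h)

end Connectivity

end HaemersConnectivity

theorem theorem2 (k : ℕ) (hk : 2 ≤ k) :
    Fintype.card (GammaVertex k) = 6 * k ∧
    (switchingSet k).card = 2 * k ∧
    IsGMSwitchingSet (gamma k) (switchingSet k) ∧
    (gamma k).IsRegularOfDegree (2 * k) ∧
    (gmSwitch (gamma k) (switchingSet k)).IsRegularOfDegree (2 * k) ∧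
    adjSpectrum (gamma k) = adjSpectrum (gmSwitch (gamma k) (switchingSet k)) ∧
    vertexConnectivity (gamma k) = 2 * k ∧
    vertexConnectivity (gmSwitch (gamma k) (switchingSet k)) = k + 1 :=
  ⟨card_gammaVertex hk, card_switchingSet k, isGMSwitchingSet_switchingSet hk,
    gamma_isRegularOfDegree hk, gmSwitch_isRegularOfDegree hk, adjSpectrum_gamma_eq hk,
    vertexConnectivity_gamma hk, vertexConnectivity_gmSwitch hk⟩
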